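/- Let $K$ be a field, $n\ge 0$ an integer, $S=K[x_1,\dots,x_n]$ with its standard $\mathbb{Z}^n$-grading and $\mathfrak{m}=(x_1,\dots,x_n)$. Let $Q_1,Q_2,Q_3$ be three non-zero irreducible monomial ideals of $S$ (that is, ideals generated by monomials, proper, and not the intersection of two strictly larger ideals of $S$), not necessarily distinct, and let $R=S/(Q_1\cap Q_2\cap Q_3)$. Then $$\operatorname{sdepth} R\ \ge\ \operatorname{depth} R,$$ that is, Stanley's conjecture holds for $R$. Here $\operatorname{depth} R$ is the maximal length of an $R$-regular sequence of elements of $\mathfrak{m}$. A Stanley decomposition $\mathcal{D}$ of $R$ is a presentation of the $K$-vector space $R$ as a finite direct sum $R=\bigoplus_{i=1}^r z_iK[Z_i]$ with $z_i\in R$ homogeneous for the $\mathbb{Z}^n$-grading and $Z_i\subseteq\{x_1,\dots,x_n\}$, such that each $z_iK[Z_i]=\{z_if: f\in K[Z_i]\}$ is a free $K[Z_i]$-module with basis $z_i$; one sets $\operatorname{sdepth}\mathcal{D}=\min_i|Z_i|$, and $\operatorname{sdepth} R$ is the maximum of $\operatorname{sdepth}\mathcal{D}$ over all Stanley decompositions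 $\mathcal{D}$ of $R$. -/

import Mathlib

open MvPolynomial

namespace StanleyDepth

/-- An ideal of a polynomial ring is monomial if it is generated by a set of monomials. -/
def IsMonomialIdeal {K σ : Type*} [Field K] (I : Ideal (MvPolynomial σ K)) : Prop :=
  ∃ A : Set (σ →₀ ℕ), I = Ideal.span ((fun a => monomial a (1 : K)) '' A)

/-- The graded maximal ideal of a polynomial ring, generated by all the variables. -/
noncomputable def irrelevantIdeal (K σ : Type*) [Field K] : Ideal (MvPolynomial σ K) :=
  Ideal.span (Set.range X)

/-- The depth of a module over a polynomial ring with respect to the graded maximal ideal: the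
supremum of the lengths of the regular sequences on `M` whose members lie in that ideal. -/
noncomputable def depth (K σ M : Type*) [Field K] [AddCommGroup M]
    [Module (MvPolynomial σ K) M] : ℕ∞ :=
  ⨆ (rs : List (MvPolynomial σ K)) (_ : ∀ f ∈ rs, f ∈ irrelevantIdeal K σ)
    (_ : RingTheory.Sequence.IsRegular M rs), (rs.length : ℕ∞)

/-- The map `f ↦ f z` from `K[Z]`, the polynomials in the variables from `Z`, to `M`. -/
noncomputable def stanleyMap {K σ M : Type*} [Field K] [AddCommGroup M] [Module K M]
    [Module (MvPolynomial σ K) M] [IsScalarTower K (MvPolynomial σ K) M]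
    (z : M) (Z : Finset σ) : supported K (Z : Set σ) →ₗ[K] M :=
  ((LinearMap.toSpanSingleton (MvPolynomial σ K) M z).restrictScalars K) ∘ₗ
    (supported K (Z : Set σ)).val.toLinearMap

/-- The `K`-subspace `z K[Z]` of `M`. -/
noncomputable def stanleySpace {K σ M : Type*} [Field K] [AddCommGroup M] [Module K M]
    [Module (MvPolynomial σ K) M] [IsScalarTower K (MvPolynomial σ K) M]
    (z : M) (Z : Finset σ) : Submodule K M :=
  LinearMap.range (stanleyMap (K := K) z Z)

/-- A Stanley decomposition of a module `M` with graded pieces `𝒜 a`: a presentation of the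
`K`-vector space `M` as a finite (internal) direct sum of subspaces `z i K[Z i]`, where each `z i`
is homogeneous and each `z i K[Z i]` is free over `K[Z i]` on the generator `z i`. -/
structure StanleyDecomposition {K σ M ι : Type*} [Field K] [AddCommGroup M] [Module K M]
    [Module (MvPolynomial σ K) M] [IsScalarTower K (MvPolynomial σ K) M]
    (𝒜 : ι → Submodule K M) where
  /-- the number of summands -/
  r : ℕ
  /-- the generators -/
  z : Fin r → M
  /-- the sets of variables -/
  Z : Fin r → Finset σ
  homogeneous : ∀ i, ∃ a, z i ∈ 𝒜 a
  free : ∀ i, Function.Injective (stanleyMap (K := K) (z i) (Z i))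
  isInternal : DirectSum.IsInternal fun i => stanleySpace (K := K) (z i) (Z i)

/-- The Stanley depth of a Stanley decomposition: the least number of variables of a summand. -/
noncomputable def StanleyDecomposition.sdepth {K σ M ι : Type*} [Field K] [AddCommGroup M]
    [Module K M] [Module (MvPolynomial σ K) M] [IsScalarTower K (MvPolynomial σ K) M]
    {𝒜 : ι → Submodule K M} (D : StanleyDecomposition (σ := σ) 𝒜) : ℕ∞ :=
  ⨅ i, ((D.Z i).card : ℕ∞)

/-- The Stanley depth of a module `M` with graded pieces `𝒜 a`: the supremum of the Stanley depths
of its Stanley decompositions. -/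
noncomputable def sdepth {K M ι : Type*} (σ : Type*) [Field K] [AddCommGroup M] [Module K M]
    [Module (MvPolynomial σ K) M] [IsScalarTower K (MvPolynomial σ K) M]
    (𝒜 : ι → Submodule K M) : ℕ∞ :=
  ⨆ D : StanleyDecomposition (σ := σ) 𝒜, D.sdepth

/-- The multigrading of `S ⧸ I` for a monomial ideal `I` of `S = K[x_s : s ∈ σ]`: the piece of
degree `a` is spanned by the class of the monomial `x ^ a`. (All pieces whose degree has a
negative coordinate vanish, so they are left out.) -/
noncomputable def quotientGrading {K σ : Type*} [Field K] (I : Ideal (MvPolynomial σ K))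
    (a : σ →₀ ℕ) : Submodule K (MvPolynomial σ K ⧸ I) :=
  Submodule.span K {Ideal.Quotient.mk I (monomial a (1 : K))}

end StanleyDepth

/-! ### Vanishing of Ext groups along short exact sequences -/

section ExtVanishing

open CategoryTheory Abelian

universe u

variable {R : Type u} [CommRing R]

/-! Each irreducible monomial ideal Qᵢ is generated by powers of some of the variables; let Fᵢ be
the set of the remaining variables and F = F₁ ∩ F₂ ∩ F₃. A regular sequence of length r in the
maximal ideal makes the Ext groups of the residue field vanish below r, and it suffices to turn this
vanishing into a partition of the monomials outside Q₁ ∩ Q₂ ∩ Q₃ into cones of dimension at least r.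

After discarding redundant components, an Ischebeck-type argument gives r ≤ |Fᵢ| for each i
(`le_card_free_of_extVanish`). Mayer–Vietoris sequences, together with distributivity of the lattice
of monomial ideals, give bounds in terms of |Fᵢ ∩ Fⱼ| and |F| (`DepthGE.le_of_inf_powIdeal`,
`DepthGE.le_card_inter_add_two`).

The monomials are sorted by the first Qᵢ that misses them. Each piece is cut into cones by splitting
along the nonfree variables; the basic device is that one prescribed variable can be kept in every
cone when intersecting with an ideal (`isConeUnion_inter_powSet`).

If r ≤ |F| + 1, one kept variable suffices. If no Fᵢ ∩ Fⱼ lies in the third set, then r ≤ |F| + 2,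
and two extra variables can be kept. Otherwise, say, F₂ ∩ F₃ ⊆ F₁ and r > |F| + 1; the depth bounds
then force Q₁ ⊆ Q₂ + Q₃, so the third piece reduces to one that involves only two ideals. -/

/-- The groups `Ext^i(R ⧸ m, M)` vanish for all `i < r`. -/
def ExtVanish (m : Ideal R) (M : Type u) [AddCommGroup M] [Module R M] (r : ℕ) : Prop :=
  ∀ i < r, Subsingleton (Ext (ModuleCat.of R (R ⧸ m)) (ModuleCat.of R M) i)

namespace ExtVanish

variable {m : Ideal R} {M N P : Type u} [AddCommGroup M] [Module R M] [AddCommGroup N] [Module R N]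
  [AddCommGroup P] [Module R P] {r s : ℕ}

lemma mono (h : ExtVanish m M r) (hs : s ≤ r) : ExtVanish m M s :=
  fun i hi => h i (hi.trans_le hs)

variable {f : M →ₗ[R] N} {g : N →ₗ[R] P}

lemma _root_.ModuleCat.shortExact_of_exact (hf : Function.Injective f)
    (hfg : Function.Exact f g) (hg : Function.Surjective g) :
    (ModuleCat.shortComplexOfCompEqZero f g hfg.linearMap_comp_eq_zero).ShortExact where
  exact := ModuleCat.shortComplex_exact _ hfg
  mono_f := (ModuleCat.mono_iff_injective _).2 hf
  epi_g := (ModuleCat.epi_iff_surjective _).2 hg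

lemma of_middle (hf : Function.Injective f) (hfg : Function.Exact f g)
    (hg : Function.Surjective g) (hM : ExtVanish m M r) (hP : ExtVanish m P r) :
    ExtVanish m N r := by
  intro i hi
  have hM := hM i hi
  have hP := hP i hi
  refine subsingleton_of_forall_eq 0 fun x => ?_
  obtain ⟨y, rfl⟩ := Ext.covariant_sequence_exact₂ (ModuleCat.of R (R ⧸ m))
    (ModuleCat.shortExact_of_exact hf hfg hg) x (hP.elim _ _)
  rw [show y = 0 from hM.elim _ _, Ext.zero_comp]

lemma of_right (hf : Function.Injective f) (hfg : Function.Exact f g)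
    (hg : Function.Surjective g) (hM : ExtVanish m M (r + 1)) (hN : ExtVanish m N r) :
    ExtVanish m P r := by
  intro i hi
  have hM := hM (i + 1) (by lia)
  have hN := hN i hi
  refine subsingleton_of_forall_eq 0 fun x => ?_
  obtain ⟨y, rfl⟩ := Ext.covariant_sequence_exact₃ (ModuleCat.of R (R ⧸ m))
    (ModuleCat.shortExact_of_exact hf hfg hg) x rfl (hM.elim _ _)
  rw [show y = 0 from hN.elim _ _, Ext.zero_comp]

/-- Stated for a single class killed by `f`, so that it also applies when `f` is multiplication by
an element of `m`, which kills every class although the Ext groups of the target need not vanish. -/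
lemma eq_zero_of_comp_eq_zero (hf : Function.Injective f) (hfg : Function.Exact f g)
    (hg : Function.Surjective g) (hP : ExtVanish m P r) {i : ℕ} (hi : i < r + 1)
    (x : Ext (ModuleCat.of R (R ⧸ m)) (ModuleCat.of R M) i)
    (hx : x.comp (Ext.mk₀ (ModuleCat.ofHom f)) (add_zero i) = 0) : x = 0 := by
  cases i with
  | zero =>
    have := (ModuleCat.mono_iff_injective (ModuleCat.ofHom f)).2 hf
    refine Ext.postcomp_mk₀_injective_of_mono _ (ModuleCat.ofHom f) ?_
    rw [map_zero]
    exact hx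
  | succ i =>
    have hP := hP i (by lia)
    obtain ⟨y, rfl⟩ := Ext.covariant_sequence_exact₁ (ModuleCat.of R (R ⧸ m))
      (ModuleCat.shortExact_of_exact hf hfg hg) x hx rfl
    rw [show y = 0 from hP.elim _ _, Ext.zero_comp]

lemma of_left (hf : Function.Injective f) (hfg : Function.Exact f g)
    (hg : Function.Surjective g) (hN : ExtVanish m N (r + 1)) (hP : ExtVanish m P r) :
    ExtVanish m M (r + 1) := fun i hi =>
  have hN := hN i hi
  subsingleton_of_forall_eq 0 fun x =>
    eq_zero_of_comp_eq_zero hf hfg hg hP hi x (hN.elim _ _)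

end ExtVanish

namespace Ideal

variable {m I J : Ideal R} {r : ℕ}

/-- The Mayer–Vietoris sequence 0 → R/(I ∩ J) → R/I × R/J → R/(I + J) → 0, in its middle term. -/
lemma exact_quotient_inf_sup (I J : Ideal R) :
    Function.Exact
      ((Submodule.factor (inf_le_left : I ⊓ J ≤ I)).prod
        (Submodule.factor (inf_le_right : I ⊓ J ≤ J)))
      ((Submodule.factor (le_sup_left : I ≤ I ⊔ J)).coprod
        (-(Submodule.factor (le_sup_right : J ≤ I ⊔ J)))) := by
  rintro ⟨x, y⟩
  obtain ⟨x, rfl⟩ := Submodule.mkQ_surjective I x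
  obtain ⟨y, rfl⟩ := Submodule.mkQ_surjective J y
  constructor
  · intro h
    have h : x - y ∈ I ⊔ J := by
      rw [← Submodule.Quotient.mk_eq_zero]
      simpa [sub_eq_add_neg] using h
    obtain ⟨a, ha, b, hb, hab⟩ := Submodule.mem_sup.1 h
    refine ⟨Submodule.Quotient.mk (x - a), ?_⟩
    refine Prod.ext ?_ ?_
    · exact (Submodule.Quotient.eq _).2 (by simpa using ha)
    · exact (Submodule.Quotient.eq _).2 (by
        change x - a - y ∈ J
        rwa [show x - a - y = b by rw [sub_right_comm, ← hab]; ring])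
  · rintro ⟨z, hz⟩
    obtain ⟨z, rfl⟩ := Submodule.mkQ_surjective _ z
    rw [← hz]
    simp

lemma injective_quotient_inf (I J : Ideal R) :
    Function.Injective ((Submodule.factor (inf_le_left : I ⊓ J ≤ I)).prod
        (Submodule.factor (inf_le_right : I ⊓ J ≤ J))) := by
  rw [← LinearMap.ker_eq_bot, LinearMap.ker_eq_bot']
  intro x hx
  obtain ⟨x, rfl⟩ := Submodule.mkQ_surjective _ x
  have h := Prod.ext_iff.1 hx
  exact (Submodule.Quotient.mk_eq_zero _).2
    ⟨(Submodule.Quotient.mk_eq_zero _).1 h.1, (Submodule.Quotient.mk_eq_zero _).1 h.2⟩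

lemma surjective_quotient_sup (I J : Ideal R) :
    Function.Surjective ((Submodule.factor (le_sup_left : I ≤ I ⊔ J)).coprod
        (-(Submodule.factor (le_sup_right : J ≤ I ⊔ J)))) := by
  intro x
  obtain ⟨x, rfl⟩ := Submodule.mkQ_surjective _ x
  exact ⟨(Submodule.Quotient.mk x, 0), by simp⟩

lemma extVanish_prod {M N : Type u} [AddCommGroup M] [Module R M] [AddCommGroup N] [Module R N]
    (hM : ExtVanish m M r) (hN : ExtVanish m N r) : ExtVanish m (M × N) r :=
  ExtVanish.of_middle (f := LinearMap.inl R M N) (g := LinearMap.snd R M N)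
    LinearMap.inl_injective .inl_snd LinearMap.snd_surjective hM hN

lemma extVanish_sup (h : ExtVanish m (R ⧸ I ⊓ J) (r + 1)) (hI : ExtVanish m (R ⧸ I) r)
    (hJ : ExtVanish m (R ⧸ J) r) : ExtVanish m (R ⧸ I ⊔ J) r :=
  ExtVanish.of_right (injective_quotient_inf I J) (exact_quotient_inf_sup I J)
    (surjective_quotient_sup I J) h (extVanish_prod hI hJ)

lemma extVanish_inf (h : ExtVanish m (R ⧸ I ⊔ J) r) (hI : ExtVanish m (R ⧸ I) (r + 1))
    (hJ : ExtVanish m (R ⧸ J) (r + 1)) : ExtVanish m (R ⧸ I ⊓ J) (r + 1) :=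
  ExtVanish.of_left (injective_quotient_inf I J) (exact_quotient_inf_sup I J)
    (surjective_quotient_sup I J) (extVanish_prod hI hJ) h

variable {x : R}

lemma injective_lsmul_quotient (hx : ∀ y, x * y ∈ I → y ∈ I) :
    Function.Injective (LinearMap.lsmul R (R ⧸ I) x) := by
  rw [← LinearMap.ker_eq_bot, LinearMap.ker_eq_bot']
  intro y hy
  obtain ⟨y, rfl⟩ := Submodule.mkQ_surjective _ y
  exact (Submodule.Quotient.mk_eq_zero _).2 (hx y ((Submodule.Quotient.mk_eq_zero _).1 hy))

lemma exact_lsmul_quotient (I : Ideal R) (x : R) :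
    Function.Exact (LinearMap.lsmul R (R ⧸ I) x)
      (Submodule.factor (le_sup_left : I ≤ I ⊔ span {x})) := by
  intro y
  obtain ⟨y, rfl⟩ := Submodule.mkQ_surjective _ y
  constructor
  · intro h
    have h : y ∈ I ⊔ span {x} := (Submodule.Quotient.mk_eq_zero _).1 h
    obtain ⟨a, ha, b, hb, hab⟩ := Submodule.mem_sup.1 h
    obtain ⟨c, rfl⟩ := mem_span_singleton'.1 hb
    refine ⟨Submodule.Quotient.mk c, (Submodule.Quotient.eq _).2 ?_⟩
    change x * c - _ ∈ I
    rw [← hab, mul_comm x c, sub_add_cancel_right]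
    exact I.neg_mem ha
  · rintro ⟨z, hz⟩
    obtain ⟨z, rfl⟩ := Submodule.mkQ_surjective _ z
    rw [← hz]
    exact (Submodule.Quotient.mk_eq_zero _).2
      (mul_mem_right z _ (mem_sup_right (mem_span_singleton_self x)))

lemma surjective_factor {I J : Ideal R} (h : I ≤ J) : Function.Surjective (Submodule.factor h) := by
  intro y
  obtain ⟨y, rfl⟩ := Submodule.mkQ_surjective _ y
  exact ⟨Submodule.Quotient.mk y, rfl⟩

lemma ext_smul_eq_zero {M : Type u} [AddCommGroup M] [Module R M] {i : ℕ} (hx : x ∈ m)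
    (e : Ext (ModuleCat.of R (R ⧸ m)) (ModuleCat.of R M) i) : x • e = 0 := by
  have h : x • 𝟙 (ModuleCat.of R (R ⧸ m)) = 0 := by
    ext1
    refine LinearMap.ext fun y => ?_
    obtain ⟨y, rfl⟩ := Submodule.mkQ_surjective _ y
    exact (Submodule.Quotient.mk_eq_zero _).2 (mul_mem_right y _ hx)
  have : x • e = (Ext.mk₀ (x • 𝟙 (ModuleCat.of R (R ⧸ m)))).comp e (zero_add i) := by
    simp [Ext.mk₀_smul]
  rw [this, h, Ext.mk₀_zero, Ext.zero_comp]

lemma extVanish_of_sup_span (hxm : x ∈ m) (hx : ∀ y, x * y ∈ I → y ∈ I)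
    (h : ExtVanish m (R ⧸ I ⊔ span {x}) r) : ExtVanish m (R ⧸ I) (r + 1) := fun i hi =>
  subsingleton_of_forall_eq 0 fun e => by
    refine ExtVanish.eq_zero_of_comp_eq_zero (injective_lsmul_quotient hx)
      (exact_lsmul_quotient I x) (surjective_factor _) h hi e ?_
    rw [show ModuleCat.ofHom (LinearMap.lsmul R (R ⧸ I) x) =
      x • 𝟙 (ModuleCat.of R (R ⧸ I)) from rfl, ← Ext.smul_eq_comp_mk₀]
    exact ext_smul_eq_zero hxm e

/-- Nakayama's lemma: being killed by some s ≡ 1 mod `m` is the substitute for vanishing after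
localization at `m`. If s kills the image of e under the connecting map, then s e = x e', hence e =
x e' - (s - 1) e lies in `m` times the Ext group, which is finitely generated. -/
lemma exists_smul_ext_eq_zero [IsNoetherianRing R] {M : Type u} [AddCommGroup M] [Module R M]
    [Module.Finite R M] (hxm : x ∈ m) (hx : ∀ y, x * y ∈ I → y ∈ I) {i : ℕ}
    (h : ∀ e : Ext (ModuleCat.of R (R ⧸ I ⊔ span {x})) (ModuleCat.of R M) (i + 1),
      ∃ s : R, s - 1 ∈ m ∧ s • e = 0)
    (e : Ext (ModuleCat.of R (R ⧸ I)) (ModuleCat.of R M) i) : ∃ s : R, s - 1 ∈ m ∧ s • e = 0 := by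
  suffices H : (⊤ : Submodule R (Ext (ModuleCat.of R (R ⧸ I)) (ModuleCat.of R M) i)) ≤ m • ⊤ by
    obtain ⟨s, hs, hs'⟩ := Submodule.exists_sub_one_mem_and_smul_eq_zero_of_fg_of_le_smul m _
      Module.Finite.fg_top H
    exact ⟨s, hs, hs' e trivial⟩
  intro e _
  have hS := ModuleCat.shortExact_of_exact (injective_lsmul_quotient hx)
      (exact_lsmul_quotient I x) (surjective_factor _)
  obtain ⟨s, hs, hse⟩ := h (hS.extClass.comp e (add_comm 1 i))
  obtain ⟨e', he'⟩ := Ext.contravariant_sequence_exact₁ hS (ModuleCat.of R M) (s • e)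
    (add_comm 1 i) (by rw [Ext.comp_smul]; exact hse)
  have he'' : x • e' = s • e := by
    rw [← he']
    change _ = (Ext.mk₀ (x • 𝟙 (ModuleCat.of R (R ⧸ I)))).comp e' _
    simp [Ext.mk₀_smul]
  rw [show e = x • e' - (s - 1) • e by rw [he'', sub_smul, one_smul, sub_sub_cancel]]
  exact sub_mem (Submodule.smul_mem_smul hxm trivial) (Submodule.smul_mem_smul hs trivial)

end Ideal

lemma RingTheory.Sequence.IsRegular.extVanish [IsNoetherianRing R] {m : Ideal R} {M : Type u}
    [AddCommGroup M] [Module R M] [Module.Finite R M]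
    (hM : m • (⊤ : Submodule R M) < ⊤) {rs : List R} (hm : ∀ x ∈ rs, x ∈ m)
    (h : RingTheory.Sequence.IsRegular M rs) : ExtVanish m M rs.length :=
  ModuleCat.subsingleton_ext_of_exists_isRegular m (ModuleCat.of R (R ⧸ m))
    (by rw [Module.support_eq_zeroLocus, Ideal.annihilator_quotient]) (ModuleCat.of R M) hM rs hm h

end ExtVanishing

namespace StanleyDepth

/-! ### Monomial ideals and ideals generated by powers of variables -/

section MonomialIdeals

variable {K σ : Type*} [Field K] {I J L : Ideal (MvPolynomial σ K)}

lemma IsMonomialIdeal.mem_iff (hI : IsMonomialIdeal I) {f : MvPolynomial σ K} :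
    f ∈ I ↔ ∀ u ∈ f.support, monomial u (1 : K) ∈ I := by
  classical
  obtain ⟨A, rfl⟩ := hI
  simp [mem_ideal_span_monomial_image, support_monomial]

lemma isMonomialIdeal_of_forall
    (h : ∀ f ∈ I, ∀ u ∈ f.support, monomial u (1 : K) ∈ I) : IsMonomialIdeal I := by
  refine ⟨{u | monomial u (1 : K) ∈ I}, le_antisymm (fun f hf => ?_) ?_⟩
  · exact mem_ideal_span_monomial_image.2 fun u hu => ⟨u, h f hf u hu, le_rfl⟩
  · rw [Ideal.span_le]
    rintro _ ⟨u, hu, rfl⟩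
    exact hu

lemma monomial_mem_of_le {u v : σ →₀ ℕ} (h : monomial u (1 : K) ∈ I) (huv : u ≤ v) :
    monomial v (1 : K) ∈ I := by
  rw [show monomial v (1 : K) = monomial (v - u) 1 * monomial u 1 by
    rw [monomial_mul, tsub_add_cancel_of_le huv, one_mul]]
  exact I.mul_mem_left _ h

lemma IsMonomialIdeal.le_iff (hI : IsMonomialIdeal I) :
    I ≤ J ↔ ∀ u, monomial u (1 : K) ∈ I → monomial u (1 : K) ∈ J := by
  refine ⟨fun h u hu => h hu, fun h => ?_⟩
  obtain ⟨A, rfl⟩ := hI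
  rw [Ideal.span_le]
  rintro _ ⟨u, hu, rfl⟩
  exact h u (Ideal.subset_span ⟨u, hu, rfl⟩)

lemma IsMonomialIdeal.ext (hI : IsMonomialIdeal I) (hJ : IsMonomialIdeal J)
    (h : ∀ u, monomial u (1 : K) ∈ I ↔ monomial u (1 : K) ∈ J) : I = J :=
  le_antisymm (hI.le_iff.2 fun u => (h u).1) (hJ.le_iff.2 fun u => (h u).2)

lemma IsMonomialIdeal.top : IsMonomialIdeal (⊤ : Ideal (MvPolynomial σ K)) :=
  isMonomialIdeal_of_forall fun _ _ _ _ => trivial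

lemma IsMonomialIdeal.inf (hI : IsMonomialIdeal I) (hJ : IsMonomialIdeal J) :
    IsMonomialIdeal (I ⊓ J) :=
  isMonomialIdeal_of_forall fun _ hf u hu => ⟨hI.mem_iff.1 hf.1 u hu, hJ.mem_iff.1 hf.2 u hu⟩

lemma IsMonomialIdeal.sup (hI : IsMonomialIdeal I) (hJ : IsMonomialIdeal J) :
    IsMonomialIdeal (I ⊔ J) := by
  obtain ⟨A, rfl⟩ := hI
  obtain ⟨B, rfl⟩ := hJ
  exact ⟨A ∪ B, by rw [Set.image_union, Ideal.span_union]⟩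

lemma IsMonomialIdeal.monomial_mem_sup (hI : IsMonomialIdeal I) (hJ : IsMonomialIdeal J)
    {u : σ →₀ ℕ} :
    monomial u (1 : K) ∈ I ⊔ J ↔ monomial u (1 : K) ∈ I ∨ monomial u (1 : K) ∈ J := by
  classical
  obtain ⟨A, rfl⟩ := hI
  obtain ⟨B, rfl⟩ := hJ
  rw [← Ideal.span_union, ← Set.image_union]
  simp [mem_ideal_span_monomial_image, support_monomial, or_and_right, exists_or]

/-- On sets of monomials, sum and intersection of ideals become union and intersection, which
distribute. -/
lemma IsMonomialIdeal.inf_sup_right (hI : IsMonomialIdeal I) (hJ : IsMonomialIdeal J)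
    (hL : IsMonomialIdeal L) : I ⊓ J ⊔ L = (I ⊔ L) ⊓ (J ⊔ L) :=
  ((hI.inf hJ).sup hL).ext ((hI.sup hL).inf (hJ.sup hL)) fun u => by
    simp only [(hI.inf hJ).monomial_mem_sup hL, Ideal.mem_inf, hI.monomial_mem_sup hL,
      hJ.monomial_mem_sup hL]
    tauto

/-- The ideal generated by the powers `x_i ^ q i` of the variables `x_i` with `q i ≠ 0`. -/
noncomputable def powIdeal (K : Type*) [Field K] (q : σ →₀ ℕ) : Ideal (MvPolynomial σ K) :=
  Ideal.span ((fun a => monomial a (1 : K)) '' ((fun i => Finsupp.single i (q i)) '' q.support))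

lemma isMonomialIdeal_powIdeal (q : σ →₀ ℕ) : IsMonomialIdeal (powIdeal K q) := ⟨_, rfl⟩

lemma monomial_mem_powIdeal {q u : σ →₀ ℕ} :
    monomial u (1 : K) ∈ powIdeal K q ↔ ∃ i, q i ≠ 0 ∧ q i ≤ u i := by
  classical
  simp [powIdeal, mem_ideal_span_monomial_image, support_monomial]

lemma powIdeal_sup (q q' : σ →₀ ℕ) : ∃ p, powIdeal K q ⊔ powIdeal K q' = powIdeal K p ∧
    ∀ i, p i = 0 ↔ q i = 0 ∧ q' i = 0 := by
  classical
  -- The exponent is the minimum, with 0 read as infinity because it marks an absent variable.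
  refine ⟨Finsupp.zipWith (fun a b => if a = 0 then b else if b = 0 then a else min a b)
    (by simp) q q', ?_, fun i => ?_⟩
  · refine ((isMonomialIdeal_powIdeal q).sup (isMonomialIdeal_powIdeal q')).ext
      (isMonomialIdeal_powIdeal _) fun u => ?_
    rw [(isMonomialIdeal_powIdeal q).monomial_mem_sup (isMonomialIdeal_powIdeal q')]
    simp only [monomial_mem_powIdeal, ← exists_or, Finsupp.zipWith_apply]
    refine exists_congr fun i => ?_
    grind
  · simp only [Finsupp.zipWith_apply]
    grind

lemma powIdeal_sup_span_X {q : σ →₀ ℕ} {j : σ} (hj : q j = 0) :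
    powIdeal K q ⊔ Ideal.span {X j} = powIdeal K (q + Finsupp.single j 1) := by
  classical
  have h : IsMonomialIdeal (Ideal.span {X j} : Ideal (MvPolynomial σ K)) :=
    ⟨{Finsupp.single j 1}, by rw [Set.image_singleton]; rfl⟩
  refine ((isMonomialIdeal_powIdeal q).sup h).ext (isMonomialIdeal_powIdeal _) fun u => ?_
  rw [(isMonomialIdeal_powIdeal q).monomial_mem_sup h]
  have h' : monomial u (1 : K) ∈ Ideal.span {X j} ↔ 1 ≤ u j := by
    rw [show (Ideal.span {X j} : Ideal (MvPolynomial σ K)) =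
      Ideal.span ((fun a => monomial a (1 : K)) '' {Finsupp.single j 1}) by
        rw [Set.image_singleton]; rfl]
    rw [mem_ideal_span_monomial_image]
    simp [support_monomial]
  simp only [monomial_mem_powIdeal, h', Finsupp.add_apply, Finsupp.single_apply]
  constructor
  · rintro (⟨i, hi, hiu⟩ | h)
    · exact ⟨i, by grind⟩
    · exact ⟨j, by grind⟩
  · rintro ⟨i, hi, hiu⟩
    grind

lemma mem_powIdeal_of_X_mul_mem {q : σ →₀ ℕ} {j : σ} (hj : q j = 0) {f : MvPolynomial σ K}
    (hf : X j * f ∈ powIdeal K q) : f ∈ powIdeal K q := by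
  classical
  rw [(isMonomialIdeal_powIdeal q).mem_iff] at hf ⊢
  intro u hu
  have h := hf (Finsupp.single j 1 + u) (by rw [mem_support_iff, coeff_X_mul]; simpa using hu)
  rw [monomial_mem_powIdeal] at h ⊢
  obtain ⟨i, hi, hiu⟩ := h
  refine ⟨i, hi, ?_⟩
  rwa [Finsupp.add_apply, Finsupp.single_eq_of_ne (by grind), zero_add] at hiu

lemma constantCoeff_eq_zero_of_mem {f : MvPolynomial σ K} (hf : f ∈ irrelevantIdeal K σ) :
    constantCoeff f = 0 := by
  have : irrelevantIdeal K σ ≤ RingHom.ker (constantCoeff (σ := σ) (R := K)) := by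
    rw [irrelevantIdeal, Ideal.span_le]
    rintro _ ⟨i, rfl⟩
    simp
  exact this hf

lemma IsMonomialIdeal.le_irrelevantIdeal (hI : IsMonomialIdeal I) (h : I ≠ ⊤) :
    I ≤ irrelevantIdeal K σ := by
  rw [hI.le_iff]
  intro u hu
  have hu0 : u ≠ 0 := by
    rintro rfl
    exact h ((Ideal.eq_top_iff_one I).2 hu)
  obtain ⟨i, hi⟩ := Finsupp.ne_iff.1 hu0
  refine monomial_mem_of_le (u := Finsupp.single i 1) (Ideal.subset_span ⟨i, rfl⟩) ?_
  rw [Finsupp.single_le_iff]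
  exact Nat.one_le_iff_ne_zero.2 hi

lemma powIdeal_ne_top (q : σ →₀ ℕ) : powIdeal K q ≠ ⊤ := by
  rw [Ne, Ideal.eq_top_iff_one]
  intro h
  obtain ⟨i, hi, hi'⟩ := monomial_mem_powIdeal (u := 0).1 h
  exact hi (Nat.le_zero.1 hi')

lemma smul_top_quotient_lt (hI : I ≤ irrelevantIdeal K σ) :
    irrelevantIdeal K σ • (⊤ : Submodule (MvPolynomial σ K) (MvPolynomial σ K ⧸ I)) < ⊤ := by
  rw [lt_top_iff_ne_top, Ne, Submodule.eq_top_iff']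
  intro h
  have h := h (Ideal.Quotient.mk I 1)
  have h' : ∀ x ∈ irrelevantIdeal K σ •
      (⊤ : Submodule (MvPolynomial σ K) (MvPolynomial σ K ⧸ I)),
      ∀ f, Ideal.Quotient.mk I f = x → f ∈ irrelevantIdeal K σ := by
    have key : irrelevantIdeal K σ • (⊤ : Submodule (MvPolynomial σ K) (MvPolynomial σ K ⧸ I)) ≤
        Submodule.map I.mkQ (irrelevantIdeal K σ) := by
      refine Submodule.smul_le.2 fun a ha x _ => ?_
      obtain ⟨x, rfl⟩ := Submodule.mkQ_surjective _ x
      exact ⟨a * x, Ideal.mul_mem_right x _ ha, rfl⟩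
    rintro x hx f rfl
    obtain ⟨g, hg, hgf⟩ := key hx
    have := hI (Ideal.Quotient.eq.1 hgf.symm)
    simpa using add_mem this hg
  simpa using constantCoeff_eq_zero_of_mem (h' _ h 1 rfl)

end MonomialIdeals

/-! ### Depth of irreducible quotients and the bound by irredundant components -/

section ExtBounds

open CategoryTheory Abelian

variable {K : Type*} [Field K] {n : ℕ} {I J : Ideal (MvPolynomial (Fin n) K)} {r : ℕ}
  {q : Fin n →₀ ℕ}

/-- The indices of the variables on which `powIdeal K q` does not depend. -/
def free (q : Fin n →₀ ℕ) : Finset (Fin n) := {i | q i = 0}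

@[simp]
lemma mem_free {i : Fin n} : i ∈ free q ↔ q i = 0 := by simp [free]

lemma free_add_single (j : Fin n) :
    free (q + Finsupp.single j 1) = (free q).erase j := by
  ext i
  simp only [mem_free, Finset.mem_erase, Finsupp.add_apply, Finsupp.single_apply]
  grind

/-- The free variables form a regular sequence; they are factored out one at a time. -/
lemma extVanish_powIdeal (q : Fin n →₀ ℕ) :
    ExtVanish (irrelevantIdeal K (Fin n)) (MvPolynomial (Fin n) K ⧸ powIdeal K q)
      (free q).card := by
  generalize hk : (free q).card = k
  induction k generalizing q with
  | zero => exact fun i hi => absurd hi (Nat.not_lt_zero i)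
  | succ k ih =>
    obtain ⟨j, hj⟩ := Finset.card_pos.1 (by lia : 0 < (free q).card)
    have hj' := mem_free.1 hj
    refine Ideal.extVanish_of_sup_span (x := X j) (Ideal.subset_span (Set.mem_range_self j))
      (fun f hf => mem_powIdeal_of_X_mul_mem hj' hf) ?_
    rw [powIdeal_sup_span_X hj']
    exact ih _ (by rw [free_add_single j, Finset.card_erase_of_mem hj, hk]; rfl)

lemma zeroLocus_powIdeal_subset (hq : free q = ∅) :
    PrimeSpectrum.zeroLocus (powIdeal K q : Set (MvPolynomial (Fin n) K)) ⊆
      PrimeSpectrum.zeroLocus (irrelevantIdeal K (Fin n)) := by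
  rw [PrimeSpectrum.zeroLocus_subset_zeroLocus_iff, irrelevantIdeal, Ideal.span_le]
  rintro _ ⟨i, rfl⟩
  refine ⟨q i, ?_⟩
  rw [X_pow_eq_monomial, monomial_mem_powIdeal]
  refine ⟨i, fun h => ?_, by simp⟩
  simpa [hq] using mem_free.2 h

/-- Ischebeck's vanishing Ext^i(S/Q, M) = 0 for i < depth M - dim S/Q, up to localization, by
induction on dim S/Q: adjoining a free variable to Q lowers the dimension by one and raises i by
one. -/
lemma exists_smul_ext_powIdeal_eq_zero (hI : I ≤ irrelevantIdeal K (Fin n))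
    (h : ExtVanish (irrelevantIdeal K (Fin n)) (MvPolynomial (Fin n) K ⧸ I) r)
    (q : Fin n →₀ ℕ) {i : ℕ} (hi : i + (free q).card < r)
    (e : Ext (ModuleCat.of (MvPolynomial (Fin n) K) (MvPolynomial (Fin n) K ⧸ powIdeal K q))
      (ModuleCat.of (MvPolynomial (Fin n) K) (MvPolynomial (Fin n) K ⧸ I)) i) :
    ∃ s, s - 1 ∈ irrelevantIdeal K (Fin n) ∧ s • e = 0 := by
  generalize hk : (free q).card = k at hi
  induction k generalizing q i with
  | zero =>
    -- With no free variable left, S/Q is supported at the maximal ideal, so a regular sequence of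
    -- length r kills its Ext groups below r just as for the residue field.
    obtain ⟨rs, hlen, hmem, hreg⟩ := ModuleCat.exists_isRegular_of_exists_subsingleton_ext
      (irrelevantIdeal K (Fin n)) r (ModuleCat.of _ (MvPolynomial (Fin n) K ⧸ I))
      (smul_top_quotient_lt hI)
      (ModuleCat.of _ (MvPolynomial (Fin n) K ⧸ irrelevantIdeal K (Fin n)))
      (by rw [Module.support_eq_zeroLocus, Ideal.annihilator_quotient]) h
    have := ModuleCat.subsingleton_ext_of_exists_isRegular (irrelevantIdeal K (Fin n))
      (ModuleCat.of _ (MvPolynomial (Fin n) K ⧸ powIdeal K q))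
      (by
        rw [Module.support_eq_zeroLocus, Ideal.annihilator_quotient]
        exact zeroLocus_powIdeal_subset (Finset.card_eq_zero.1 hk))
      (ModuleCat.of _ (MvPolynomial (Fin n) K ⧸ I)) (smul_top_quotient_lt hI) rs hmem hreg i
      (by lia)
    exact ⟨1, by simp, this.elim _ _⟩
  | succ k ih =>
    obtain ⟨j, hj⟩ := Finset.card_pos.1 (by lia : 0 < (free q).card)
    have hj' := mem_free.1 hj
    refine Ideal.exists_smul_ext_eq_zero (x := X j) (Ideal.subset_span (Set.mem_range_self j))
      (fun f hf => mem_powIdeal_of_X_mul_mem hj' hf) ?_ e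
    rw [powIdeal_sup_span_X hj']
    exact fun e => ih _ e (by rw [free_add_single j, Finset.card_erase_of_mem hj, hk]; rfl)
      (by lia)

/-- The depth of a quotient by a monomial ideal is at most the dimension of an irredundant
irreducible component. -/
lemma le_card_free_of_extVanish (hJ : IsMonomialIdeal J) (hJq : ¬ J ≤ powIdeal K q)
    (h : ExtVanish (irrelevantIdeal K (Fin n)) (MvPolynomial (Fin n) K ⧸ J ⊓ powIdeal K q) r) :
    r ≤ (free q).card := by
  by_contra! hr
  rw [hJ.le_iff] at hJq
  push Not at hJq
  obtain ⟨u, huJ, huq⟩ := hJq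
  -- A monomial of `J` outside `powIdeal K q` induces a nonzero map between the quotients;
  -- Ischebeck's vanishing in degree 0 contradicts it.
  let φ : (MvPolynomial (Fin n) K ⧸ powIdeal K q) →ₗ[MvPolynomial (Fin n) K]
      (MvPolynomial (Fin n) K ⧸ J ⊓ powIdeal K q) :=
    Submodule.mapQ (powIdeal K q) (J ⊓ powIdeal K q) (LinearMap.lsmul _ _ (monomial u (1 : K)))
      fun f hf => Ideal.mem_inf.2 ⟨J.mul_mem_right f huJ, Ideal.mul_mem_left _ _ hf⟩
  obtain ⟨s, hs, hsφ⟩ := exists_smul_ext_powIdeal_eq_zero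
    (inf_le_right.trans ((isMonomialIdeal_powIdeal q).le_irrelevantIdeal (powIdeal_ne_top q)))
    h q (i := 0) (by lia) (Ext.mk₀ (ModuleCat.ofHom φ))
  rw [← Ext.mk₀_smul, Ext.mk₀_eq_zero_iff] at hsφ
  have hφ : s • φ = 0 := congrArg ModuleCat.Hom.hom hsφ
  have hφ1 : s * (monomial u (1 : K) * 1) ∈ J ⊓ powIdeal K q :=
    (Submodule.Quotient.mk_eq_zero _).1
      (LinearMap.congr_fun hφ (Submodule.Quotient.mk (1 : MvPolynomial (Fin n) K)))
  have hs1 : constantCoeff s = 1 := by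
    simpa [sub_eq_zero] using constantCoeff_eq_zero_of_mem hs
  -- The coefficient of x ^ u in s x ^ u is the constant term of s, namely 1.
  refine huq ((isMonomialIdeal_powIdeal q).mem_iff.1 hφ1.2 u ?_)
  rw [mem_support_iff, mul_one, show coeff u (s * monomial u (1 : K)) = 1 by
    simpa [hs1, ← constantCoeff_eq] using coeff_mul_monomial 0 u (1 : K) s]
  exact one_ne_zero

lemma le_card_free_of_extVanish_powIdeal
    (h : ExtVanish (irrelevantIdeal K (Fin n)) (MvPolynomial (Fin n) K ⧸ powIdeal K q) r) :
    r ≤ (free q).card :=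
  le_card_free_of_extVanish IsMonomialIdeal.top
    (fun h' => powIdeal_ne_top q (top_le_iff.1 h')) (by rwa [top_inf_eq])

lemma powIdeal_sup_free (q q' : Fin n →₀ ℕ) :
    ∃ p, powIdeal K q ⊔ powIdeal K q' = powIdeal K p ∧ free p = free q ∩ free q' := by
  obtain ⟨p, hp, hp'⟩ := powIdeal_sup (K := K) q q'
  exact ⟨p, hp, by ext i; simp [hp']⟩

end ExtBounds

/-! ### Depth bounds from Mayer–Vietoris sequences -/

section DepthBounds

variable {K : Type*} [Field K] {n : ℕ} {I J : Ideal (MvPolynomial (Fin n) K)} {r b : ℕ}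
  {q q₁ q₂ q₃ : Fin n →₀ ℕ}

/-- The depth of `S ⧸ I` is at least `r`, in terms of the vanishing of `Ext` groups. -/
def DepthGE (I : Ideal (MvPolynomial (Fin n) K)) (r : ℕ) : Prop :=
  ExtVanish (irrelevantIdeal K (Fin n)) (MvPolynomial (Fin n) K ⧸ I) r

lemma DepthGE.mono (h : DepthGE I r) (hb : b ≤ r) : DepthGE I b := ExtVanish.mono h hb

lemma DepthGE.sup (h : DepthGE (I ⊓ J) (r + 1)) (hI : DepthGE I r) (hJ : DepthGE J r) :
    DepthGE (I ⊔ J) r := Ideal.extVanish_sup h hI hJ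

lemma DepthGE.inf (h : DepthGE (I ⊔ J) r) (hI : DepthGE I (r + 1)) (hJ : DepthGE J (r + 1)) :
    DepthGE (I ⊓ J) (r + 1) := Ideal.extVanish_inf h hI hJ

lemma depthGE_powIdeal_iff : DepthGE (powIdeal K q) r ↔ r ≤ (free q).card :=
  ⟨le_card_free_of_extVanish_powIdeal, fun h => (extVanish_powIdeal q).mono h⟩

lemma DepthGE.le_card_free (h : DepthGE (J ⊓ powIdeal K q) r) (hJ : IsMonomialIdeal J)
    (hJq : ¬ J ≤ powIdeal K q) : r ≤ (free q).card :=
  le_card_free_of_extVanish hJ hJq h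

lemma depthGE_powIdeal_sup_iff :
    DepthGE (powIdeal K q₁ ⊔ powIdeal K q₂) r ↔ r ≤ (free q₁ ∩ free q₂).card := by
  obtain ⟨p, hp, hp'⟩ := powIdeal_sup_free (K := K) q₁ q₂
  rw [hp, depthGE_powIdeal_iff, hp']

lemma depthGE_powIdeal_inf (h₁ : r ≤ (free q₁).card) (h₂ : r ≤ (free q₂).card)
    (h : r ≤ (free q₁ ∩ free q₂).card + 1) : DepthGE (powIdeal K q₁ ⊓ powIdeal K q₂) r := by
  cases r with
  | zero => exact fun i hi => absurd hi (Nat.not_lt_zero i)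
  | succ r =>
    have h' : DepthGE (powIdeal K q₁ ⊔ powIdeal K q₂) r := depthGE_powIdeal_sup_iff.2 (by lia)
    exact h'.inf (depthGE_powIdeal_iff.2 h₁) (depthGE_powIdeal_iff.2 h₂)

lemma DepthGE.le_card_free_inter (h : DepthGE (powIdeal K q₁ ⊓ powIdeal K q₂) r)
    (h₁ : r ≤ (free q₁).card) (h₂ : r ≤ (free q₂).card) :
    r ≤ (free q₁ ∩ free q₂).card + 1 := by
  cases r with
  | zero => lia
  | succ r =>
    have := depthGE_powIdeal_sup_iff.1 (h.sup (depthGE_powIdeal_iff.2 (by lia))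
      (depthGE_powIdeal_iff.2 (by lia)))
    lia

/-- If r ≥ b + 2 with b = |F₁ ∩ F₂|, Mayer–Vietoris for Q₃ ∩ Q₁ and Q₂ gives depth at least b + 1
for the quotient by (Q₃ + Q₂) ∩ (Q₁ + Q₂). Either Q₁ + Q₂ is an irredundant component, of dimension
only b, or Q₃ + Q₂ ⊆ Q₁ + Q₂ and the intersection is Q₃ + Q₂, so that b + 1 ≤ |F₂ ∩ F₃|; the last
hypothesis excludes the second case. -/
lemma DepthGE.le_of_inf_powIdeal (h : DepthGE (powIdeal K q₁ ⊓ powIdeal K q₂ ⊓ powIdeal K q₃) r)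
    (h₁ : r ≤ (free q₁).card) (h₂ : r ≤ (free q₂).card) (h₃ : r ≤ (free q₃).card)
    (h₁₃ : (free q₁ ∩ free q₂).card ≤ (free q₁ ∩ free q₃).card)
    (h' : ¬ powIdeal K q₃ ≤ powIdeal K q₁ ⊔ powIdeal K q₂ ∨
      (free q₂ ∩ free q₃).card ≤ (free q₁ ∩ free q₂).card) :
    r ≤ (free q₁ ∩ free q₂).card + 1 := by
  by_contra! hr
  set b := (free q₁ ∩ free q₂).card with hb
  have hI : powIdeal K q₁ ⊓ powIdeal K q₂ ⊓ powIdeal K q₃ =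
      powIdeal K q₃ ⊓ powIdeal K q₁ ⊓ powIdeal K q₂ := by
    rw [inf_assoc, inf_comm, inf_comm (powIdeal K q₂), inf_right_comm, inf_assoc, inf_comm,
      inf_comm (powIdeal K q₁)]
  have h₂₃ : powIdeal K q₃ ⊓ powIdeal K q₁ ⊔ powIdeal K q₂ =
      (powIdeal K q₃ ⊔ powIdeal K q₂) ⊓ (powIdeal K q₁ ⊔ powIdeal K q₂) :=
    (isMonomialIdeal_powIdeal _).inf_sup_right (isMonomialIdeal_powIdeal _)
      (isMonomialIdeal_powIdeal _)
  have key := (show DepthGE _ (b + 1 + 1) from (hI ▸ h).mono (by lia)).sup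
    (depthGE_powIdeal_inf (by lia) (by lia) (by rw [Finset.inter_comm (free q₃)]; lia))
    (depthGE_powIdeal_iff.2 (by lia))
  rw [h₂₃] at key
  by_cases hle : powIdeal K q₃ ⊔ powIdeal K q₂ ≤ powIdeal K q₁ ⊔ powIdeal K q₂
  · rw [inf_eq_left.2 hle, depthGE_powIdeal_sup_iff, Finset.inter_comm] at key
    rcases h' with h' | h'
    · exact h' (le_sup_left.trans hle)
    · lia
  · obtain ⟨p, hp, hp'⟩ := powIdeal_sup_free (K := K) q₁ q₂
    rw [hp] at key hle
    have := key.le_card_free ((isMonomialIdeal_powIdeal _).sup (isMonomialIdeal_powIdeal _)) hle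
    rw [hp'] at this
    lia

/-- Two Mayer–Vietoris steps, each losing one, lead from the intersection to Q₁ + Q₂ + Q₃, whose
quotient has depth |F|. The strict inequalities provide the depth of the intermediate terms. -/
lemma DepthGE.le_card_inter_add_two
    (h : DepthGE (powIdeal K q₁ ⊓ powIdeal K q₂ ⊓ powIdeal K q₃) r)
    (h₁ : r ≤ (free q₁).card) (h₂ : r ≤ (free q₂).card) (h₃ : r ≤ (free q₃).card)
    (h₁₂ : (free q₁ ∩ free q₂ ∩ free q₃).card < (free q₁ ∩ free q₂).card)
    (h₁₃ : (free q₁ ∩ free q₂ ∩ free q₃).card < (free q₁ ∩ free q₃).card)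
    (h₂₃ : (free q₁ ∩ free q₂ ∩ free q₃).card < (free q₂ ∩ free q₃).card) :
    r ≤ (free q₁ ∩ free q₂ ∩ free q₃).card + 2 := by
  by_contra! hr
  set f := (free q₁ ∩ free q₂ ∩ free q₃).card with hf
  have key := (h.mono (b := f + 1 + 1 + 1) (by lia)).sup
    (depthGE_powIdeal_inf (by lia) (by lia) (by lia)) (depthGE_powIdeal_iff.2 (by lia))
  rw [(isMonomialIdeal_powIdeal _).inf_sup_right (isMonomialIdeal_powIdeal _)
      (isMonomialIdeal_powIdeal _)] at key
  obtain ⟨p, hp, hp'⟩ := powIdeal_sup_free (K := K) q₁ q₃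
  obtain ⟨p', hpp, hpp'⟩ := powIdeal_sup_free (K := K) q₂ q₃
  have key := key.sup (depthGE_powIdeal_sup_iff.2 (by lia)) (depthGE_powIdeal_sup_iff.2 (by lia))
  rw [hp, hpp, depthGE_powIdeal_sup_iff, hp', hpp', ← Finset.inter_inter_distrib_right] at key
  lia

lemma depth_le_of_forall {d : ℕ∞} (hI : I ≤ irrelevantIdeal K (Fin n))
    (h : ∀ r, DepthGE I r → (r : ℕ∞) ≤ d) : depth K (Fin n) (MvPolynomial (Fin n) K ⧸ I) ≤ d :=
  iSup_le fun _ => iSup_le fun hmem => iSup_le fun hreg =>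
    h _ (hreg.extVanish (smul_top_quotient_lt hI) hmem)

end DepthBounds

/-! ### Structure of irreducible monomial ideals -/

section Irreducible

variable {K σ : Type*} [Field K] {Q : Ideal (MvPolynomial σ K)}

/-- For coprime monomials the lcm is the product, so (Q + (x ^ v)) ∩ (Q + (x ^ w)) = Q, and
irreducibility applies. -/
lemma mem_or_mem_of_infIrred (hQ : InfIrred Q) (hm : IsMonomialIdeal Q) {v w : σ →₀ ℕ}
    (hvw : Disjoint v w) (h : monomial (v + w) (1 : K) ∈ Q) :
    monomial v (1 : K) ∈ Q ∨ monomial w (1 : K) ∈ Q := by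
  classical
  have hspan (v : σ →₀ ℕ) : IsMonomialIdeal (Ideal.span {monomial v (1 : K)}) :=
    ⟨{v}, by rw [Set.image_singleton]⟩
  have hmem (u v : σ →₀ ℕ) : monomial u (1 : K) ∈ Ideal.span {monomial v (1 : K)} ↔ v ≤ u := by
    rw [← Set.image_singleton (f := fun v => monomial v (1 : K)), mem_ideal_span_monomial_image]
    simp [support_monomial]
  have key : (Q ⊔ Ideal.span {monomial v 1}) ⊓ (Q ⊔ Ideal.span {monomial w 1}) = Q := by
    refine ((hm.sup (hspan v)).inf (hm.sup (hspan w))).ext hm fun u => ?_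
    rw [Ideal.mem_inf, hm.monomial_mem_sup (hspan v), hm.monomial_mem_sup (hspan w), hmem, hmem]
    refine ⟨?_, fun h => ⟨.inl h, .inl h⟩⟩
    rintro ⟨h₁ | h₁, h₂ | h₂⟩
    · exact h₁
    · exact h₁
    · exact h₂
    · refine monomial_mem_of_le h ?_
      intro i
      have h₀ := DFunLike.congr_fun (disjoint_iff.1 hvw) i
      have := h₁ i
      have := h₂ i
      simp only [Finsupp.inf_apply, bot_eq_zero, Finsupp.coe_zero, Pi.zero_apply,
        Finsupp.add_apply] at h₀ ⊢
      grind
  refine (hQ.2 key).imp (fun h => ?_) fun h => ?_ <;>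
  · rw [← h]
    exact Ideal.mem_sup_right (Ideal.mem_span_singleton_self _)

/-- An irreducible monomial ideal is generated by powers of variables. -/
lemma exists_eq_powIdeal [Finite σ] (hQ : InfIrred Q) (hm : IsMonomialIdeal Q) :
    ∃ q : σ →₀ ℕ, Q = powIdeal K q := by
  classical
  have h1 : (1 : MvPolynomial σ K) ∉ Q := by
    rw [← Ideal.eq_top_iff_one]
    rintro rfl
    exact hQ.1 isMax_top
  have key (u : σ →₀ ℕ) (hu : monomial u (1 : K) ∈ Q) :
      ∃ i, monomial (Finsupp.single i (u i)) (1 : K) ∈ Q := by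
    induction u using Finsupp.induction with
    | zero => exact absurd hu h1
    | single_add i k f hi hk ih =>
      have hfi : f i = 0 := Finsupp.notMem_support_iff.1 hi
      rcases mem_or_mem_of_infIrred hQ hm (disjoint_iff.2 (Finsupp.ext fun j => by
        simp only [Finsupp.inf_apply, bot_eq_zero, Finsupp.coe_zero, Pi.zero_apply,
          Finsupp.single_apply]
        grind)) hu with h | h
      · exact ⟨i, by simpa [hfi] using h⟩
      · obtain ⟨j, hj⟩ := ih h
        exact ⟨j, monomial_mem_of_le hj (Finsupp.single_mono (by simp))⟩
  -- If no power of x_i lies in Q, then `sInf ∅ = 0` correctly marks the variable as absent;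
  -- otherwise the least exponent is nonzero since 1 ∉ Q.
  refine ⟨Finsupp.equivFunOnFinite.symm fun i =>
    sInf {k | monomial (Finsupp.single i k) (1 : K) ∈ Q}, ?_⟩
  refine hm.ext (isMonomialIdeal_powIdeal _) fun u => ?_
  rw [monomial_mem_powIdeal]
  simp only [Finsupp.coe_equivFunOnFinite_symm]
  constructor
  · intro hu
    obtain ⟨i, hi⟩ := key u hu
    refine ⟨i, fun h => ?_, Nat.sInf_le hi⟩
    have : _ ∈ {k | monomial (Finsupp.single i k) (1 : K) ∈ Q} := Nat.sInf_mem ⟨_, hi⟩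
    rw [h] at this
    exact h1 (by simpa using this)
  · rintro ⟨i, hi, hiu⟩
    refine monomial_mem_of_le (Nat.sInf_mem (Nat.nonempty_of_pos_sInf (Nat.pos_of_ne_zero hi)))
      (Finsupp.single_le_iff.2 hiu)

end Irreducible

/-! ### Splitting sets of exponents into cones -/

section Cones

variable {n : ℕ} {p p' : Finset (Fin n) → Prop} {T T' W : Set (Fin n →₀ ℕ)}

/-- The exponents of the monomials in `x ^ u K[Z]`. -/
def cone (u : Fin n →₀ ℕ) (Z : Finset (Fin n)) : Set (Fin n →₀ ℕ) :=
  {v | u ≤ v ∧ ∀ i ∉ Z, v i = u i}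

/-- A set of exponents is a finite disjoint union of cones `cone u Z` with `Z` satisfying `p`. -/
inductive IsConeUnion (p : Finset (Fin n) → Prop) : Set (Fin n →₀ ℕ) → Prop
  | empty : IsConeUnion p ∅
  | cone (u : Fin n →₀ ℕ) (Z : Finset (Fin n)) (hZ : p Z) : IsConeUnion p (cone u Z)
  | union (T T' : Set (Fin n →₀ ℕ)) (hT : IsConeUnion p T) (hT' : IsConeUnion p T')
      (h : Disjoint T T') : IsConeUnion p (T ∪ T')

lemma IsConeUnion.mono (hT : IsConeUnion p T) (h : ∀ Z, p Z → p' Z) : IsConeUnion p' T := by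
  induction hT with
  | empty => exact .empty
  | cone u Z hZ => exact .cone u Z (h Z hZ)
  | union T T' _ _ hd hT hT' => exact .union T T' hT hT' hd

lemma IsConeUnion.bind (hT : IsConeUnion p T)
    (h : ∀ u Z, p Z → IsConeUnion p' (StanleyDepth.cone u Z ∩ W)) : IsConeUnion p' (T ∩ W) := by
  induction hT with
  | empty => rw [Set.empty_inter]; exact .empty
  | cone u Z hZ => exact h u Z hZ
  | union T T' _ _ hd hT hT' =>
    rw [Set.union_inter_distrib_right]
    exact .union _ _ hT hT' (hd.mono Set.inter_subset_left Set.inter_subset_left)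

/-- Separates the exponents whose i-th coordinate equals `u i` from those where it is larger. -/
lemma cone_eq_union {u : Fin n →₀ ℕ} {Z : Finset (Fin n)} {i : Fin n} (hi : i ∈ Z) :
    cone u Z = cone u (Z.erase i) ∪ cone (u + Finsupp.single i 1) Z := by
  ext v
  simp only [cone, Set.mem_ofPred_eq, Set.mem_union, Finsupp.le_def, Finsupp.add_apply,
    Finsupp.single_apply, Finset.mem_erase]
  constructor
  · rintro ⟨h₁, h₂⟩
    by_cases h : v i = u i
    · exact .inl ⟨h₁, by grind⟩
    · refine .inr ⟨fun j => ?_, fun j hj => ?_⟩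
      · have := h₁ j
        grind
      · grind
  · rintro (⟨h₁, h₂⟩ | ⟨h₁, h₂⟩)
    · exact ⟨h₁, by grind⟩
    · exact ⟨fun j => le_of_add_le_left (h₁ j), by grind⟩

lemma disjoint_cone {u : Fin n →₀ ℕ} {Z : Finset (Fin n)} {i : Fin n} :
    Disjoint (cone u (Z.erase i)) (cone (u + Finsupp.single i 1) Z) := by
  rw [Set.disjoint_left]
  rintro v ⟨-, hv⟩ ⟨hv', -⟩
  have h := hv i (Finset.notMem_erase i Z)
  have h' := hv' i
  simp [h] at h'

lemma IsConeUnion.of_split {u : Fin n →₀ ℕ} {Z : Finset (Fin n)} {i : Fin n} (hi : i ∈ Z)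
    (h : IsConeUnion p (StanleyDepth.cone u (Z.erase i) ∩ W))
    (h' : IsConeUnion p (StanleyDepth.cone (u + Finsupp.single i 1) Z ∩ W)) :
    IsConeUnion p (StanleyDepth.cone u Z ∩ W) := by
  rw [cone_eq_union hi, Set.union_inter_distrib_right]
  exact .union _ _ h h' (disjoint_cone.mono Set.inter_subset_left Set.inter_subset_left)

/-- The exponents of the monomials in `powIdeal K q`. -/
def powSet (q : Fin n →₀ ℕ) : Set (Fin n →₀ ℕ) := {v | ∃ i, q i ≠ 0 ∧ q i ≤ v i}

variable {q : Fin n →₀ ℕ}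

lemma cone_subset_powSet {u : Fin n →₀ ℕ} (Z : Finset (Fin n)) (hu : u ∈ powSet q) :
    cone u Z ⊆ powSet q := by
  rintro v ⟨hv, -⟩
  obtain ⟨i, hi, hiu⟩ := hu
  exact ⟨i, hi, hiu.trans (hv i)⟩

lemma disjoint_cone_powSet {u : Fin n →₀ ℕ} {Z : Finset (Fin n)} (hu : u ∉ powSet q)
    (hZ : Z ⊆ free q) : Disjoint (cone u Z) (powSet q) := by
  rw [Set.disjoint_left]
  rintro v ⟨-, hv⟩ ⟨i, hi, hiv⟩
  exact hu ⟨i, hi, hv i (fun h => hi (mem_free.1 (hZ h))) ▸ hiv⟩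

lemma sum_erase_lt {u : Fin n →₀ ℕ} {Z : Finset (Fin n)} {i : Fin n} (hu : u ∉ powSet q)
    (hi : i ∈ Z) (hq : q i ≠ 0) :
    ∑ j ∈ Z.erase i, (q j - u j) < ∑ j ∈ Z, (q j - u j) := by
  rw [← Finset.add_sum_erase Z _ hi]
  have : ¬ q i ≤ u i := fun h => hu ⟨i, hq, h⟩
  lia

lemma sum_add_single_lt {u : Fin n →₀ ℕ} {Z : Finset (Fin n)} {i : Fin n} (hu : u ∉ powSet q)
    (hi : i ∈ Z) (hq : q i ≠ 0) :
    ∑ j ∈ Z, (q j - (u + Finsupp.single i 1 : Fin n →₀ ℕ) j) < ∑ j ∈ Z, (q j - u j) := by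
  refine Finset.sum_lt_sum (fun j _ => ?_) ⟨i, hi, ?_⟩
  · rw [Finsupp.add_apply]
    lia
  · have : ¬ q i ≤ u i := fun h => hu ⟨i, hq, h⟩
    rw [Finsupp.add_apply, Finsupp.single_eq_same]
    lia

lemma isConeUnion_inter_compl_powSet (q u : Fin n →₀ ℕ) (Z : Finset (Fin n)) :
    IsConeUnion (fun Z' => Z ∩ free q ⊆ Z') (cone u Z ∩ (powSet q)ᶜ) := by
  induction hN : ∑ j ∈ Z, (q j - u j) using Nat.strong_induction_on generalizing u Z with
  | _ N ih =>
  subst hN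
  by_cases hu : u ∈ powSet q
  · rw [← Set.sdiff_eq, Set.sdiff_eq_empty.2 (cone_subset_powSet Z hu)]
    exact .empty
  by_cases hZ : Z ⊆ free q
  · rw [Set.inter_eq_left.2 (disjoint_cone_powSet hu hZ).subset_compl_right]
    exact .cone u Z Finset.inter_subset_left
  obtain ⟨i, hi, hq⟩ := Finset.not_subset.1 hZ
  rw [mem_free] at hq
  refine .of_split hi ?_ (ih _ (sum_add_single_lt hu hi hq) _ _ rfl)
  refine (ih _ (sum_erase_lt hu hi hq) _ _ rfl).mono fun Z' hZ' => ?_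
  rwa [Finset.erase_inter, Finset.erase_eq_of_notMem (by simp [hq])] at hZ'

/-- The intersection of `x ^ u K[Z]` with a monomial complete intersection splits into cones
in which a prescribed variable of `Z` is still free. -/
lemma isConeUnion_inter_powSet (q u : Fin n →₀ ℕ) (Z : Finset (Fin n)) (b : Fin n) :
    IsConeUnion (fun Z' => Z ∩ free q ⊆ Z' ∧ (b ∈ Z → b ∈ Z')) (cone u Z ∩ powSet q) := by
  induction hN : ∑ j ∈ Z, (q j - u j) using Nat.strong_induction_on generalizing u Z with
  | _ N ih =>
  subst hN
  by_cases hu : u ∈ powSet q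
  · rw [Set.inter_eq_left.2 (cone_subset_powSet Z hu)]
    exact .cone u Z ⟨Finset.inter_subset_left, id⟩
  by_cases hZ : Z ⊆ free q
  · rw [(disjoint_cone_powSet hu hZ).inter_eq]
    exact .empty
  by_cases hZ' : ∃ i ∈ Z, q i ≠ 0 ∧ i ≠ b
  · obtain ⟨i, hi, hq, hib⟩ := hZ'
    refine .of_split hi ?_ (ih _ (sum_add_single_lt hu hi hq) _ _ rfl)
    refine (ih _ (sum_erase_lt hu hi hq) _ _ rfl).mono fun Z' hZ' => ?_
    rw [Finset.erase_inter, Finset.erase_eq_of_notMem (by simp [hq])] at hZ'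
    exact ⟨hZ'.1, fun hb => hZ'.2 (Finset.mem_erase.2 ⟨hib.symm, hb⟩)⟩
  -- Now `b` is the only nonfree variable of `Z`, so `i = b`. The half of the split that loses `b`
  -- misses `powSet q` altogether, hence no cone without `b` arises.
  · obtain ⟨i, hi, hq⟩ := Finset.not_subset.1 hZ
    rw [mem_free] at hq
    refine .of_split hi ?_ (ih _ (sum_add_single_lt hu hi hq) _ _ rfl)
    rw [(disjoint_cone_powSet hu fun j hj => ?_).inter_eq]
    · exact .empty
    · rw [Finset.mem_erase] at hj
      rw [mem_free]
      grind

lemma isConeUnion_compl_powSet (q : Fin n →₀ ℕ) :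
    IsConeUnion (fun Z => free q ⊆ Z) (powSet q)ᶜ := by
  have h := isConeUnion_inter_compl_powSet q 0 Finset.univ
  have h0 : cone (0 : Fin n →₀ ℕ) Finset.univ = Set.univ :=
    Set.eq_univ_of_forall fun v => ⟨zero_le, by simp⟩
  rwa [Finset.univ_inter, h0, Set.univ_inter] at h

variable {q₁ q₂ q₃ : Fin n →₀ ℕ}

lemma isConeUnion_compl_powSet_inter (q₁ q₂ : Fin n →₀ ℕ) (b : Fin n) :
    IsConeUnion (fun Z => free q₂ ∩ free q₁ ⊆ Z ∧ (b ∈ free q₂ → b ∈ Z))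
      ((powSet q₂)ᶜ ∩ powSet q₁) :=
  (isConeUnion_compl_powSet q₂).bind fun u Z hZ =>
    (isConeUnion_inter_powSet q₁ u Z b).mono fun _ hZ' =>
      ⟨(Finset.inter_subset_inter_right hZ).trans hZ'.1, fun hb => hZ'.2 (hZ hb)⟩

/-- `b` is protected while splitting along q₁ and `b'` while splitting along q₂; each must survive
the other splitting by being free there, unless the two coincide. -/
lemma isConeUnion_compl_powSet_inter_inter (q₁ q₂ q₃ : Fin n →₀ ℕ) (b b' : Fin n) :
    IsConeUnion (fun Z => free q₃ ∩ free q₁ ∩ free q₂ ⊆ Z ∧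
        (b ∈ free q₃ → b ∈ free q₂ ∨ b' = b → b ∈ Z) ∧ (b' ∈ free q₃ → b' ∈ free q₁ → b' ∈ Z))
      ((powSet q₃)ᶜ ∩ powSet q₁ ∩ powSet q₂) :=
  (isConeUnion_compl_powSet_inter q₁ q₃ b).bind fun u Z hZ =>
    (isConeUnion_inter_powSet q₂ u Z b').mono fun _ hZ' => by
      refine ⟨(Finset.inter_subset_inter_right hZ.1).trans hZ'.1, fun h₃ h => ?_, fun h₃ h₁ => ?_⟩
      · rcases h with h | rfl
        · exact hZ'.1 (Finset.mem_inter.2 ⟨hZ.2 h₃, h⟩)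
        · exact hZ'.2 (hZ.2 h₃)
      · exact hZ'.2 (hZ.1 (Finset.mem_inter.2 ⟨h₃, h₁⟩))

lemma isConeUnion_compl_inter_powSet (h₁ : IsConeUnion p (powSet q₁)ᶜ)
    (h₂ : IsConeUnion p ((powSet q₂)ᶜ ∩ powSet q₁)) :
    IsConeUnion p (powSet q₁ ∩ powSet q₂)ᶜ := by
  rw [show (powSet q₁ ∩ powSet q₂)ᶜ = (powSet q₁)ᶜ ∪ ((powSet q₂)ᶜ ∩ powSet q₁) by
    ext; simp only [Set.mem_compl_iff, Set.mem_union, Set.mem_inter_iff]; tauto]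
  refine .union _ _ h₁ h₂ (Set.disjoint_left.2 fun v hv hv' => hv hv'.2)

lemma isConeUnion_compl_inter_inter_powSet (h₁ : IsConeUnion p (powSet q₁)ᶜ)
    (h₂ : IsConeUnion p ((powSet q₂)ᶜ ∩ powSet q₁))
    (h₃ : IsConeUnion p ((powSet q₃)ᶜ ∩ powSet q₁ ∩ powSet q₂)) :
    IsConeUnion p (powSet q₁ ∩ powSet q₂ ∩ powSet q₃)ᶜ := by
  rw [show (powSet q₁ ∩ powSet q₂ ∩ powSet q₃)ᶜ =
      (powSet q₁ ∩ powSet q₂)ᶜ ∪ ((powSet q₃)ᶜ ∩ powSet q₁ ∩ powSet q₂) by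
    ext; simp only [Set.mem_compl_iff, Set.mem_union, Set.mem_inter_iff]; tauto]
  refine .union _ _ (isConeUnion_compl_inter_powSet h₁ h₂) h₃
    (Set.disjoint_left.2 fun v hv hv' => hv ⟨hv'.1.2, hv'.2⟩)

lemma IsConeUnion.exists_fin (hT : IsConeUnion p T) :
    ∃ (r : ℕ) (u : Fin r → (Fin n →₀ ℕ)) (Z : Fin r → Finset (Fin n)), (∀ i, p (Z i)) ∧
      Pairwise (fun i j => Disjoint (StanleyDepth.cone (u i) (Z i))
        (StanleyDepth.cone (u j) (Z j))) ∧ T = ⋃ i, StanleyDepth.cone (u i) (Z i) := by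
  induction hT with
  | empty => exact ⟨0, finZeroElim, finZeroElim, finZeroElim, fun i => i.elim0, by simp⟩
  | cone u Z hZ =>
    exact ⟨1, fun _ => u, fun _ => Z, fun _ => hZ, Subsingleton.pairwise, by
      rw [Set.iUnion_const]⟩
  | union T T' _ _ hd hT hT' =>
    obtain ⟨r, u, Z, h₁, h₂, rfl⟩ := hT
    obtain ⟨r', u', Z', h₁', h₂', rfl⟩ := hT'
    rw [Set.disjoint_iUnion_left] at hd
    simp only [Set.disjoint_iUnion_right] at hd
    refine ⟨r + r', Fin.append u u', Fin.append Z Z', fun i => ?_, fun i j hij => ?_, ?_⟩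
    · induction i using Fin.addCases <;> simp [h₁, h₁']
    · induction i using Fin.addCases <;> induction j using Fin.addCases <;>
        simp only [Fin.append_left, Fin.append_right]
      · exact h₂ fun h => hij (by rw [h])
      · exact hd _ _
      · exact (hd _ _).symm
      · exact h₂' fun h => hij (by rw [h])
    · ext v
      simp only [Set.mem_union, Set.mem_iUnion]
      constructor
      · rintro (⟨i, hi⟩ | ⟨i, hi⟩)
        · exact ⟨Fin.castAdd r' i, by simpa using hi⟩
        · exact ⟨Fin.natAdd r i, by simpa using hi⟩
      · rintro ⟨i, hi⟩
        induction i using Fin.addCases with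
        | left i => exact .inl ⟨i, by simpa using hi⟩
        | right i => exact .inr ⟨i, by simpa using hi⟩

end Cones

/-! ### From cone partitions to Stanley decompositions -/

section StanleySpaces

variable {K : Type*} [Field K] {n : ℕ} {I : Ideal (MvPolynomial (Fin n) K)}

/-- The class of the monomial `x ^ v` in `S ⧸ I`. -/
noncomputable def monomialClass (I : Ideal (MvPolynomial (Fin n) K)) (v : Fin n →₀ ℕ) :
    MvPolynomial (Fin n) K ⧸ I :=
  Ideal.Quotient.mkₐ K I (monomial v (1 : K))

lemma smul_monomialClass (I : Ideal (MvPolynomial (Fin n) K)) (f : MvPolynomial (Fin n) K)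
    (u : Fin n →₀ ℕ) :
    f • monomialClass I u = Ideal.Quotient.mkₐ K I (f * monomial u (1 : K)) := rfl

lemma linearIndepOn_monomialClass (hI : IsMonomialIdeal I) :
    LinearIndepOn K (monomialClass I) {v | monomial v (1 : K) ∉ I} := by
  refine LinearIndepOn.map_injOn (v := fun v => monomial v (1 : K)) ?_
    (Ideal.Quotient.mkₐ K I).toLinearMap ?_
  · have h := (basisMonomials (Fin n) K).linearIndependent
    rw [coe_basisMonomials] at h
    exact h.linearIndepOn _
  · rw [← restrictSupport_eq_span]
    intro f hf g hg hfg
    have hmem := sub_mem hf hg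
    have hfg : f - g ∈ I := Ideal.Quotient.eq.1 hfg
    rw [mem_restrictSupport_iff] at hmem
    rw [hI.mem_iff] at hfg
    rw [← sub_eq_zero, ← support_eq_empty, Finset.eq_empty_iff_forall_notMem]
    exact fun u hu => hmem hu (hfg u hu)

lemma span_monomialClass (I : Ideal (MvPolynomial (Fin n) K)) :
    Submodule.span K (monomialClass I '' {v | monomial v (1 : K) ∉ I}) = ⊤ := by
  rw [eq_top_iff]
  rintro x -
  obtain ⟨f, rfl⟩ := Ideal.Quotient.mkₐ_surjective K I x
  rw [f.as_sum, map_sum]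
  refine sum_mem fun u _ => ?_
  rw [show monomial u (coeff u f) = coeff u f • monomial u (1 : K) by
    rw [smul_monomial, smul_eq_mul, mul_one], map_smul]
  refine Submodule.smul_mem _ _ ?_
  by_cases hu : monomial u (1 : K) ∈ I
  · rw [show Ideal.Quotient.mkₐ K I (monomial u 1) = 0 from Ideal.Quotient.eq_zero_iff_mem.2 hu]
    exact zero_mem _
  · exact Submodule.subset_span ⟨u, hu, rfl⟩

lemma add_mem_cone {f : MvPolynomial (Fin n) K} {Z : Finset (Fin n)}
    (hf : f ∈ supported K (Z : Set (Fin n))) (u : Fin n →₀ ℕ) {v : Fin n →₀ ℕ}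
    (hv : v ∈ f.support) : v + u ∈ cone u Z := by
  refine ⟨le_add_self, fun i hi => ?_⟩
  rw [Finsupp.add_apply, add_eq_right]
  by_contra h
  exact hi (mem_supported.1 hf ((mem_vars_iff_mem_support i).2 ⟨v, hv, Finsupp.mem_support_iff.2 h⟩))

lemma stanleySpace_monomialClass (I : Ideal (MvPolynomial (Fin n) K)) (u : Fin n →₀ ℕ)
    (Z : Finset (Fin n)) :
    stanleySpace (K := K) (monomialClass I u) Z =
      Submodule.span K (monomialClass I '' cone u Z) := by
  refine le_antisymm ?_ (Submodule.span_le.2 ?_)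
  · rintro _ ⟨⟨f, hf⟩, rfl⟩
    change f • monomialClass I u ∈ _
    rw [smul_monomialClass, f.as_sum, Finset.sum_mul, map_sum]
    refine sum_mem fun v hv => ?_
    rw [monomial_mul, mul_one, show monomial (v + u) (coeff v f) =
      coeff v f • monomial (v + u) (1 : K) by rw [smul_monomial, smul_eq_mul, mul_one], map_smul]
    exact Submodule.smul_mem _ _ (Submodule.subset_span ⟨_, add_mem_cone hf u hv, rfl⟩)
  · rintro _ ⟨v, ⟨huv, hv⟩, rfl⟩
    refine ⟨⟨monomial (v - u) 1, ?_⟩, ?_⟩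
    · rw [mem_supported, vars_monomial one_ne_zero]
      intro i hi
      by_contra hiZ
      simp [hv i hiZ] at hi
    · change monomial (v - u) (1 : K) • monomialClass I u = _
      rw [smul_monomialClass, monomial_mul, mul_one, tsub_add_cancel_of_le huv]
      rfl

lemma stanleyMap_injective (hI : IsMonomialIdeal I) {u : Fin n →₀ ℕ} {Z : Finset (Fin n)}
    (h : ∀ v ∈ cone u Z, monomial v (1 : K) ∉ I) :
    Function.Injective (stanleyMap (K := K) (monomialClass I u) Z) := by
  rw [← LinearMap.ker_eq_bot, LinearMap.ker_eq_bot']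
  rintro ⟨f, hf⟩ hfu
  have hfu : f * monomial u (1 : K) ∈ I := Ideal.Quotient.eq_zero_iff_mem.1 hfu
  rw [hI.mem_iff] at hfu
  refine Subtype.ext (support_eq_empty.1 (Finset.eq_empty_iff_forall_notMem.2 fun v hv => ?_))
  refine h _ (add_mem_cone hf u hv) (hfu _ ?_)
  rw [mem_support_iff, coeff_mul_monomial, mul_one]
  exact mem_support_iff.1 hv

/-- The classes of the monomials outside `I` form a basis of S/I, so a partition of them into cones
is a direct sum decomposition. -/
lemma IsConeUnion.le_sdepth {r : ℕ} (hI : IsMonomialIdeal I)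
    (h : IsConeUnion (fun Z => r ≤ Z.card) {v | monomial v (1 : K) ∉ I}) :
    (r : ℕ∞) ≤ sdepth (Fin n) (quotientGrading I) := by
  obtain ⟨s, u, Z, hZ, hd, hU⟩ := h.exists_fin
  have hsub (i : Fin s) : StanleyDepth.cone (u i) (Z i) ⊆ {v | monomial v (1 : K) ∉ I} :=
    by
    rw [hU]
    exact Set.subset_iUnion (fun i => StanleyDepth.cone (u i) (Z i)) i
  let D : StanleyDecomposition (σ := Fin n) (quotientGrading I) :=
    { r := s
      z := fun i => monomialClass I (u i)
      Z := Z
      homogeneous := fun i => ⟨u i, Submodule.mem_span_singleton_self _⟩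
      free := fun i => stanleyMap_injective hI fun v hv => hsub i hv
      isInternal := by
        simp only [stanleySpace_monomialClass]
        refine DirectSum.isInternal_submodule_of_iSupIndep_of_iSup_eq_top (fun i => ?_) ?_
        · simp only [← Submodule.span_iUnion, ← Set.image_iUnion]
          have key : ∀ C ⊆ {v | monomial v (1 : K) ∉ I}, monomialClass I '' C =
              (fun v : {v | monomial v (1 : K) ∉ I} => monomialClass I v) ''
                (Subtype.val ⁻¹' C) := by
            intro C hC
            rw [← Set.image_image (monomialClass I) Subtype.val, Subtype.image_preimage_coe,
              Set.inter_eq_right.2 hC]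
          rw [key _ (hsub i), key _ (Set.iUnion₂_subset fun j _ => hsub j)]
          refine (linearIndepOn_monomialClass hI).disjoint_span_image (Disjoint.preimage _ ?_)
          simp only [Set.disjoint_iUnion_right]
          exact fun j hj => hd (Ne.symm hj)
        · rw [← Submodule.span_iUnion, ← Set.image_iUnion, ← hU, span_monomialClass I] }
  exact le_iSup_of_le D (le_iInf fun i => Nat.cast_le.2 (hZ i))

end StanleySpaces

/-! ### Comparing cone dimensions with depth -/

section StanleyConjecture

variable {K : Type*} [Field K] {n r : ℕ} {q₁ q₂ q₃ : Fin n →₀ ℕ}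

/-- The monomials outside `I` split into finitely many cones of dimension at least `r`. -/
def HasConeDecomposition (I : Ideal (MvPolynomial (Fin n) K)) (r : ℕ) : Prop :=
  IsConeUnion (fun Z => r ≤ Z.card) {v | monomial v (1 : K) ∉ I}

lemma setOf_monomial_notMem_powIdeal (q : Fin n →₀ ℕ) :
    {v | monomial v (1 : K) ∉ powIdeal K q} = (powSet q)ᶜ := by
  ext v
  exact monomial_mem_powIdeal.not

lemma setOf_monomial_notMem_inf (q₁ q₂ : Fin n →₀ ℕ) :
    {v | monomial v (1 : K) ∉ powIdeal K q₁ ⊓ powIdeal K q₂} = (powSet q₁ ∩ powSet q₂)ᶜ := by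
  ext v
  exact (monomial_mem_powIdeal.and monomial_mem_powIdeal).not

lemma setOf_monomial_notMem_inf_inf (q₁ q₂ q₃ : Fin n →₀ ℕ) :
    {v | monomial v (1 : K) ∉ powIdeal K q₁ ⊓ powIdeal K q₂ ⊓ powIdeal K q₃} =
      (powSet q₁ ∩ powSet q₂ ∩ powSet q₃)ᶜ := by
  ext v
  exact ((monomial_mem_powIdeal.and monomial_mem_powIdeal).and monomial_mem_powIdeal).not

lemma nonempty_of_not_powIdeal_le (h : ¬ powIdeal K q₁ ≤ powIdeal K q₂) : Nonempty (Fin n) := by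
  by_contra! hn
  exact h (by rw [Subsingleton.elim q₁ q₂])

/-- Choose b in B outside F, gaining one element; if there is none, B ⊆ Z is already large enough
and b is irrelevant. -/
lemma exists_forall_le_card [Nonempty (Fin n)] {B F : Finset (Fin n)} (hB : r ≤ B.card)
    (hF : r ≤ F.card + 1) : ∃ b, ∀ Z : Finset (Fin n), F ⊆ Z → (b ∈ B → b ∈ Z) → r ≤ Z.card := by
  by_cases h : B ⊆ F
  · exact ⟨Classical.arbitrary _, fun Z hZ _ =>
      hB.trans (Finset.card_le_card (h.trans hZ))⟩
  · obtain ⟨b, hb, hbF⟩ := Finset.not_subset.1 h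
    refine ⟨b, fun Z hZ hbZ => hF.trans ?_⟩
    rw [← Finset.card_insert_of_notMem hbF]
    exact Finset.card_le_card (Finset.insert_subset (hbZ hb) hZ)

lemma isConeUnion_compl_powSet_of_le_card (h : r ≤ (free q₁).card) :
    IsConeUnion (fun Z => r ≤ Z.card) (powSet q₁)ᶜ :=
  (isConeUnion_compl_powSet q₁).mono fun _ hZ => h.trans (Finset.card_le_card hZ)

lemma isConeUnion_compl_powSet_inter_of_le_card [Nonempty (Fin n)] (h₂ : r ≤ (free q₂).card)
    (h : r ≤ (free q₁ ∩ free q₂).card + 1) :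
    IsConeUnion (fun Z => r ≤ Z.card) ((powSet q₂)ᶜ ∩ powSet q₁) := by
  rw [Finset.inter_comm] at h
  obtain ⟨b, hb⟩ := exists_forall_le_card h₂ h
  exact (isConeUnion_compl_powSet_inter q₁ q₂ b).mono fun Z hZ => hb Z hZ.1 hZ.2

lemma DepthGE.hasConeDecomposition_powIdeal (h : DepthGE (powIdeal K q₁) r) :
    HasConeDecomposition (powIdeal K q₁) r := by
  rw [HasConeDecomposition, setOf_monomial_notMem_powIdeal]
  exact isConeUnion_compl_powSet_of_le_card (depthGE_powIdeal_iff.1 h)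

lemma DepthGE.hasConeDecomposition_inf (h : DepthGE (powIdeal K q₁ ⊓ powIdeal K q₂) r) :
    HasConeDecomposition (powIdeal K q₁ ⊓ powIdeal K q₂) r := by
  by_cases h₁₂ : powIdeal K q₁ ≤ powIdeal K q₂
  · rw [inf_eq_left.2 h₁₂] at h ⊢
    exact h.hasConeDecomposition_powIdeal
  by_cases h₂₁ : powIdeal K q₂ ≤ powIdeal K q₁
  · rw [inf_eq_right.2 h₂₁] at h ⊢
    exact h.hasConeDecomposition_powIdeal
  have := nonempty_of_not_powIdeal_le h₁₂
  have h₂ := h.le_card_free (isMonomialIdeal_powIdeal _) h₁₂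
  have h₁ := (inf_comm (powIdeal K q₁) _ ▸ h).le_card_free (isMonomialIdeal_powIdeal _) h₂₁
  rw [HasConeDecomposition, setOf_monomial_notMem_inf]
  exact isConeUnion_compl_inter_powSet (isConeUnion_compl_powSet_of_le_card h₁)
    (isConeUnion_compl_powSet_inter_of_le_card h₂ (h.le_card_free_inter h₁ h₂))

lemma hasConeDecomposition_of_le_add_one [Nonempty (Fin n)] (h₁ : r ≤ (free q₁).card)
    (h₂ : r ≤ (free q₂).card) (h₃ : r ≤ (free q₃).card)
    (hr : r ≤ (free q₁ ∩ free q₂ ∩ free q₃).card + 1) :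
    HasConeDecomposition (powIdeal K q₁ ⊓ powIdeal K q₂ ⊓ powIdeal K q₃) r := by
  rw [HasConeDecomposition, setOf_monomial_notMem_inf_inf]
  refine isConeUnion_compl_inter_inter_powSet (isConeUnion_compl_powSet_of_le_card h₁)
    (isConeUnion_compl_powSet_inter_of_le_card h₂
      (hr.trans (Nat.add_le_add_right (Finset.card_le_card Finset.inter_subset_left) 1))) ?_
  obtain ⟨b, hb⟩ := exists_forall_le_card h₃ hr
  refine (isConeUnion_compl_powSet_inter_inter q₁ q₂ q₃ b b).mono fun Z hZ =>
    hb Z ?_ fun h => hZ.2.1 h (.inr rfl)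
  rw [Finset.inter_comm, ← Finset.inter_assoc]
  exact hZ.1

lemma card_add_two_le {F Z : Finset (Fin n)} {a b : Fin n} (hF : F ⊆ Z) (ha : a ∈ Z) (hb : b ∈ Z)
    (haF : a ∉ F) (hbF : b ∉ F) (hab : a ≠ b) : F.card + 2 ≤ Z.card := by
  rw [show F.card + 2 = (insert a (insert b F)).card by
    rw [Finset.card_insert_of_notMem (by simp [hab, haF]), Finset.card_insert_of_notMem hbF]]
  exact Finset.card_le_card (Finset.insert_subset ha (Finset.insert_subset hb hF))

/-- Take a, b, c in F₁ ∩ F₂, F₁ ∩ F₃, F₂ ∩ F₃ but not in the third set. Cones of the second piece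
contain F, a and the protected c; those of the third contain F, b and c. -/
lemma hasConeDecomposition_of_le_add_two (h₁ : r ≤ (free q₁).card)
    (hr : r ≤ (free q₁ ∩ free q₂ ∩ free q₃).card + 2)
    (h₁₂ : ¬ free q₁ ∩ free q₂ ⊆ free q₃) (h₁₃ : ¬ free q₁ ∩ free q₃ ⊆ free q₂)
    (h₂₃ : ¬ free q₂ ∩ free q₃ ⊆ free q₁) :
    HasConeDecomposition (powIdeal K q₁ ⊓ powIdeal K q₂ ⊓ powIdeal K q₃) r := by
  obtain ⟨a, ha, ha₃⟩ := Finset.not_subset.1 h₁₂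
  obtain ⟨b, hb, hb₂⟩ := Finset.not_subset.1 h₁₃
  obtain ⟨c, hc, hc₁⟩ := Finset.not_subset.1 h₂₃
  rw [Finset.mem_inter] at ha hb hc
  rw [HasConeDecomposition, setOf_monomial_notMem_inf_inf]
  refine isConeUnion_compl_inter_inter_powSet (isConeUnion_compl_powSet_of_le_card h₁) ?_ ?_
  · refine (isConeUnion_compl_powSet_inter q₁ q₂ c).mono fun Z hZ => hr.trans ?_
    refine card_add_two_le (a := a) (b := c) (fun i hi => hZ.1 ?_)
      (hZ.1 (Finset.mem_inter.2 ha.symm)) (hZ.2 hc.1) ?_ ?_ ?_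
    all_goals grind
  · refine (isConeUnion_compl_powSet_inter_inter q₁ q₂ q₃ c b).mono fun Z hZ => hr.trans ?_
    refine card_add_two_le (a := c) (b := b) (fun i hi => hZ.1 ?_)
      (hZ.2.1 hc.2 (.inl hc.1)) (hZ.2.2 hb.2 hb.1) ?_ ?_ ?_
    all_goals grind

lemma DepthGE.hasConeDecomposition_of_inter_subset [Nonempty (Fin n)]
    (h : DepthGE (powIdeal K q₁ ⊓ powIdeal K q₂ ⊓ powIdeal K q₃) r)
    (h₁ : r ≤ (free q₁).card) (h₂ : r ≤ (free q₂).card) (h₃ : r ≤ (free q₃).card)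
    (h₂₃ : free q₂ ∩ free q₃ ⊆ free q₁) (hr : (free q₂ ∩ free q₃).card + 1 < r) :
    HasConeDecomposition (powIdeal K q₁ ⊓ powIdeal K q₂ ⊓ powIdeal K q₃) r := by
  have c₂ : (free q₂ ∩ free q₃).card ≤ (free q₁ ∩ free q₂).card :=
    Finset.card_le_card (Finset.subset_inter h₂₃ Finset.inter_subset_left)
  have c₃ : (free q₂ ∩ free q₃).card ≤ (free q₁ ∩ free q₃).card :=
    Finset.card_le_card (Finset.subset_inter h₂₃ Finset.inter_subset_right)
  have h' : DepthGE (powIdeal K q₁ ⊓ powIdeal K q₃ ⊓ powIdeal K q₂) r := by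
    rwa [inf_right_comm]
  have h'' : DepthGE (powIdeal K q₂ ⊓ powIdeal K q₃ ⊓ powIdeal K q₁) r := by
    rwa [inf_comm, ← inf_assoc]
  -- Otherwise the depth bound for the smallest pair F₂ ∩ F₃ would contradict `hr`.
  have hle : powIdeal K q₁ ≤ powIdeal K q₂ ⊔ powIdeal K q₃ := by
    by_contra hle
    have := h''.le_of_inf_powIdeal h₂ h₃ h₁ (by rwa [Finset.inter_comm (free q₂) (free q₁)])
      (.inl hle)
    lia
  have key : r ≤ (free q₁ ∩ free q₂).card + 1 ∧ r ≤ (free q₁ ∩ free q₃).card + 1 := by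
    rcases le_total (free q₁ ∩ free q₂).card (free q₁ ∩ free q₃).card with hc | hc
    · have := h.le_of_inf_powIdeal h₁ h₂ h₃ hc (.inr c₂)
      lia
    · have := h'.le_of_inf_powIdeal h₁ h₃ h₂ hc (.inr (by rwa [Finset.inter_comm]))
      lia
  have hsub : powSet q₁ ⊆ powSet q₂ ∪ powSet q₃ := fun v hv =>
    (((isMonomialIdeal_powIdeal q₂).monomial_mem_sup (isMonomialIdeal_powIdeal q₃)).1
      (hle (monomial_mem_powIdeal.2 hv))).imp monomial_mem_powIdeal.1 monomial_mem_powIdeal.1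
  rw [HasConeDecomposition, setOf_monomial_notMem_inf_inf]
  refine isConeUnion_compl_inter_inter_powSet (isConeUnion_compl_powSet_of_le_card h₁)
    (isConeUnion_compl_powSet_inter_of_le_card h₂ key.1) ?_
  -- A monomial of Q₁ ⊆ Q₂ + Q₃ outside Q₃ lies in Q₂, so the condition of lying in Q₂ is automatic.
  rw [Set.inter_eq_left.2 fun v hv => (hsub hv.2).resolve_right hv.1]
  exact isConeUnion_compl_powSet_inter_of_le_card h₃ key.2

lemma card_inter_inter_lt {A B C : Finset (Fin n)} (h : ¬ A ∩ B ⊆ C) :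
    (A ∩ B ∩ C).card < (A ∩ B).card :=
  Finset.card_lt_card ⟨Finset.inter_subset_left, fun h' => h fun _ hi =>
    (Finset.mem_inter.1 (h' hi)).2⟩

lemma DepthGE.hasConeDecomposition_inf_inf
    (h : DepthGE (powIdeal K q₁ ⊓ powIdeal K q₂ ⊓ powIdeal K q₃) r) :
    HasConeDecomposition (powIdeal K q₁ ⊓ powIdeal K q₂ ⊓ powIdeal K q₃) r := by
  by_cases h₁₂ : powIdeal K q₁ ⊓ powIdeal K q₂ ≤ powIdeal K q₃
  · rw [inf_eq_left.2 h₁₂] at h ⊢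
    exact h.hasConeDecomposition_inf
  have e₁₃ : powIdeal K q₁ ⊓ powIdeal K q₂ ⊓ powIdeal K q₃ =
    powIdeal K q₁ ⊓ powIdeal K q₃ ⊓ powIdeal K q₂ := inf_right_comm _ _ _
  by_cases h₁₃ : powIdeal K q₁ ⊓ powIdeal K q₃ ≤ powIdeal K q₂
  · rw [e₁₃, inf_eq_left.2 h₁₃] at h ⊢
    exact h.hasConeDecomposition_inf
  have e₂₃ : powIdeal K q₁ ⊓ powIdeal K q₂ ⊓ powIdeal K q₃ =
    powIdeal K q₂ ⊓ powIdeal K q₃ ⊓ powIdeal K q₁ := by rw [inf_assoc, inf_comm]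
  by_cases h₂₃ : powIdeal K q₂ ⊓ powIdeal K q₃ ≤ powIdeal K q₁
  · rw [e₂₃, inf_eq_left.2 h₂₃] at h ⊢
    exact h.hasConeDecomposition_inf
  have := nonempty_of_not_powIdeal_le (fun h => h₁₂ (inf_le_left.trans h))
  have hm (p q : Fin n →₀ ℕ) : IsMonomialIdeal (powIdeal K p ⊓ powIdeal K q) :=
    (isMonomialIdeal_powIdeal p).inf (isMonomialIdeal_powIdeal q)
  have c₃ := h.le_card_free (hm _ _) h₁₂
  have c₂ := (e₁₃ ▸ h).le_card_free (hm _ _) h₁₃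
  have c₁ := (e₂₃ ▸ h).le_card_free (hm _ _) h₂₃
  rcases le_or_gt r ((free q₁ ∩ free q₂ ∩ free q₃).card + 1) with hr | hr
  · exact hasConeDecomposition_of_le_add_one c₁ c₂ c₃ hr
  by_cases s₂₃ : free q₂ ∩ free q₃ ⊆ free q₁
  · exact h.hasConeDecomposition_of_inter_subset c₁ c₂ c₃ s₂₃
      (by rwa [Finset.inter_assoc, Finset.inter_eq_right.2 s₂₃] at hr)
  by_cases s₁₃ : free q₁ ∩ free q₃ ⊆ free q₂
  · have e : powIdeal K q₁ ⊓ powIdeal K q₂ ⊓ powIdeal K q₃ =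
      powIdeal K q₂ ⊓ powIdeal K q₁ ⊓ powIdeal K q₃ := by rw [inf_comm (powIdeal K q₁)]
    rw [e] at h ⊢
    exact h.hasConeDecomposition_of_inter_subset c₂ c₁ c₃ s₁₃
      (by rwa [Finset.inter_right_comm, Finset.inter_eq_left.2 s₁₃] at hr)
  by_cases s₁₂ : free q₁ ∩ free q₂ ⊆ free q₃
  · have e : powIdeal K q₁ ⊓ powIdeal K q₂ ⊓ powIdeal K q₃ =
      powIdeal K q₃ ⊓ powIdeal K q₁ ⊓ powIdeal K q₂ := by rw [inf_comm, inf_assoc]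
    rw [e] at h ⊢
    exact h.hasConeDecomposition_of_inter_subset c₃ c₁ c₂ s₁₂
      (by rwa [Finset.inter_eq_left.2 s₁₂] at hr)
  refine hasConeDecomposition_of_le_add_two c₁ (h.le_card_inter_add_two c₁ c₂ c₃
    (card_inter_inter_lt s₁₂) ?_ ?_) s₁₂ s₁₃ s₂₃
  · rw [Finset.inter_right_comm]
    exact card_inter_inter_lt s₁₃
  · rw [Finset.inter_assoc, Finset.inter_comm]
    exact card_inter_inter_lt s₂₃

end StanleyConjecture

end StanleyDepth

theorem theorems3 {K : Type*} [Field K] (n : ℕ) (Q₁ Q₂ Q₃ : Ideal (MvPolynomial (Fin n) K))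
    (h₁ : Q₁ ≠ ⊥) (h₂ : Q₂ ≠ ⊥) (h₃ : Q₃ ≠ ⊥)
    (hm₁ : StanleyDepth.IsMonomialIdeal Q₁) (hm₂ : StanleyDepth.IsMonomialIdeal Q₂)
    (hm₃ : StanleyDepth.IsMonomialIdeal Q₃)
    (hi₁ : InfIrred Q₁) (hi₂ : InfIrred Q₂) (hi₃ : InfIrred Q₃) :
    StanleyDepth.depth K (Fin n) (MvPolynomial (Fin n) K ⧸ (Q₁ ⊓ Q₂ ⊓ Q₃)) ≤
      StanleyDepth.sdepth (Fin n) (StanleyDepth.quotientGrading (Q₁ ⊓ Q₂ ⊓ Q₃)) := by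
  have hI := (hm₁.inf hm₂).inf hm₃
  obtain ⟨q₁, rfl⟩ := StanleyDepth.exists_eq_powIdeal hi₁ hm₁
  obtain ⟨q₂, rfl⟩ := StanleyDepth.exists_eq_powIdeal hi₂ hm₂
  obtain ⟨q₃, rfl⟩ := StanleyDepth.exists_eq_powIdeal hi₃ hm₃
  exact StanleyDepth.depth_le_of_forall
    (inf_le_right.trans (hm₃.le_irrelevantIdeal (StanleyDepth.powIdeal_ne_top q₃)))
    fun r hr => hr.hasConeDecomposition_inf_inf.le_sdepth hI
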